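/- **Theorem (Diers).** Let $\mathcal B$ be a locally finitely presentable category and $U:\mathcal A\to\mathcal B$ a right multi-adjoint functor: for every object $B$ of $\mathcal B$ there is a small family of morphisms $\eta_x:B\to U(A_x)$, $x\in X_B$ (the *local units* under $B$), such that every morphism $f:B\to U(A)$ factorizes as $f=U(a)\circ\eta_x$ for a unique pair $(x\in X_B,\ a:A_x\to A)$. Call a morphism of $\mathcal B$ *diagonally universal* if it is left orthogonal (with unique diagonal fillers) to $U(a)$ for every morphism $a$ of $\mathcal A$. Let $\mathcal D_B$ be the full subcategory of the coslice $B\downarrow\mathcal B$ on the morphisms $n:B\to C$ that are pushouts, along some $K\to B$, of a diagonally universal morphism $K\to L$ between finitely presentable objects. For $n\in\mathcal D_B$ and $x\in X_B$ write $n\le x$ if $\eta_x$ factorizes through $n$, and put $D_n=\{x\in X_B: n\le x\}$. Assume that $U$ is a *Diers context*: for all $B$ and $x\in X_B$, the full subcategory $V_x=\{n\in\mathcal D_B: n\le x\}$ of $B\downarrow\mathcal B$ is filtered and $\eta_x$ is the colimit in $B\downarrow\mathcal B$ of the inclusion of $V_x$. A *$U$-space* is a topological space $X$ with a sheaf $\mathbb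 A$ of $\mathcal B$-objects, a family $(A_x)_{x\in X}$ of objects of $\mathcal A$ and isomorphisms $\mathbb A|_x\simeq U(A_x)$ for the stalks. A morphism $(X_1,\mathbb A_1,(A^1_x))\to(X_2,\mathbb A_2,(A^2_x))$ of $U$-spaces consists of a continuous map $f:X_2\to X_1$, a morphism of sheaves $\phi^\sharp:\mathbb A_1\to f_*\mathbb A_2$ and morphisms $u_x:A^1_{f(x)}\to A^2_x$ of $\mathcal A$ ($x\in X_2$) such that the stalk map $\mathbb A_1|_{f(x)}\to\mathbb A_2|_x$ induced by $\phi^\sharp$ is $U(u_x)$ through the given isomorphisms. Let $\Gamma:U\text{-}\mathrm{Spaces}\to\mathcal B$ be the functor of global sections, $\Gamma(X,\mathbb A,(A_x))=\mathbb A(X)$. For $B$ in $\mathcal B$ equip $X_B$ with the *spectral topology* $\tau_B$, generated by the sets $D_n$, $n\in\mathcal D_B$. Then: 1. The *structural sheaf* $\widetilde B$ of $B$ exists: the codomain functor $\mathcal D_B\to\mathcal B$, $n\mapsto\mathrm{cod}(n)$, has a pointwise left Kan extension $\overline B(u)=\operatorname{colim}_{u\subseteq D_n}\mathrm{cod}(n)$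 along $D:\mathcal D_B\to\tau_B^{op}$, $n\mapsto D_n$, and $\overline B$ has a sheafification $\widetilde B$. Write $s_n:\mathrm{cod}(n)\to\overline B(D_n)\to\widetilde B(D_n)$ for the canonical maps. 2. For every choice of structural sheaves $\widetilde B$, there are isomorphisms $\widetilde B|_x\simeq U(A_x)$, for all $B$ and $x\in X_B$, under which the composite $\mathrm{cod}(n)\xrightarrow{s_n}\widetilde B(D_n)\to\widetilde B|_x\simeq U(A_x)$ is equal to every $m:\mathrm{cod}(n)\to U(A_x)$ with $m\circ n=\eta_x$; and there is a functor $$\mathrm{Spec}:\mathcal B\to U\text{-}\mathrm{Spaces},\qquad \mathrm{Spec}(B)=((X_B,\tau_B),\widetilde B,(A_x)_{x\in X_B}),$$ that is left adjoint to $\Gamma$, with unit $B\xrightarrow{s_{1_B}}\widetilde B(X_B)=\Gamma\,\mathrm{Spec}(B)$. On a morphism $f:B_1\to B_2$, the functor is described as follows. On points, $\mathrm{Spec}(f)$ sends $x\in X_{B_2}$ to the $y\in X_{B_1}$ for which $\eta_x\circ f$ factorizes as $U(a)\circ\eta_y$, with $u_x=a$. On sections, whenever $n_i\in\mathcal D_{B_i}$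 and $h:\mathrm{cod}(n_1)\to\mathrm{cod}(n_2)$ satisfies $h\circ n_1=n_2\circ f$, one has $D_{n_2}\subseteq\mathrm{Spec}(f)^{-1}(D_{n_1})$, and the composite of $s_{n_1}$, of the comorphism $\widetilde B_1(D_{n_1})\to\widetilde B_2(\mathrm{Spec}(f)^{-1}(D_{n_1}))$ and of the restriction to $D_{n_2}$ is $s_{n_2}\circ h$. -/

import Mathlib

open CategoryTheory CategoryTheory.Limits TopologicalSpace Opposite AlgebraicGeometry

universe v v₁ u u₁

namespace Diers

/-- A locally finitely presentable category is cocomplete. -/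
instance hasColimits_of_lfp (ℬ : Type u) [Category.{v} ℬ]
    [h : IsLocallyFinitelyPresentable.{v} ℬ] : HasColimits ℬ :=
  h.toHasColimitsOfSize

variable {𝒜 : Type u₁} [Category.{v₁} 𝒜] {ℬ : Type u} [Category.{v} ℬ]

/-! ### Right multi-adjoints and diagonally universal morphisms -/

/-- The structure of a right multi-adjoint on `U`: under every object `B` there is a small family of
local units `unit x : B ⟶ U (obj x)`, such that every morphism `B ⟶ U A` factorizes as
`unit x ≫ U.map a` for a unique pair `(x, a)`. -/
structure RightMultiadjoint (U : 𝒜 ⥤ ℬ) where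
  /-- the set indexing the local units under `B` -/
  X : ℬ → Type v
  /-- the local object of which a local unit takes values -/
  obj : ∀ {B : ℬ}, X B → 𝒜
  /-- the local units -/
  unit : ∀ {B : ℬ} (x : X B), B ⟶ U.obj (obj x)
  existsUnique_factorization : ∀ {B : ℬ} {A : 𝒜} (f : B ⟶ U.obj A),
    ∃! p : Σ x : X B, obj x ⟶ A, unit p.1 ≫ U.map p.2 = f

/-- Diagonally universal morphisms: those that are left orthogonal (with unique diagonal fillers) to
every `U.map a`. -/
def diagUniv (U : 𝒜 ⥤ ℬ) : MorphismProperty ℬ := fun B C n =>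
  ∀ ⦃A₁ A₂ : 𝒜⦄ (a : A₁ ⟶ A₂) (g : B ⟶ U.obj A₁) (h : C ⟶ U.obj A₂),
    g ≫ U.map a = n ≫ h → ∃! d : C ⟶ U.obj A₁, n ≫ d = g ∧ d ≫ U.map a = h

/-- The diagonally universal morphisms of finite presentation under `B`: the pushouts along
morphisms `K ⟶ B` of diagonally universal morphisms `K ⟶ L` between finitely presentable objects. -/
def isBasic (U : 𝒜 ⥤ ℬ) (B : ℬ) : ObjectProperty (Under B) := fun n =>
  ∃ (K L : ℬ) (k : K ⟶ L) (g : K ⟶ B) (h : L ⟶ n.right),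
    IsFinitelyPresentable.{v} K ∧ IsFinitelyPresentable.{v} L ∧ diagUniv U k ∧
      IsPushout g k n.hom h

/-- The category `𝒟_B` of diagonally universal morphisms of finite presentation under `B`, a full
subcategory of the coslice under `B`. -/
abbrev Basic (U : 𝒜 ⥤ ℬ) (B : ℬ) := (isBasic U B).FullSubcategory

/-- The functor sending a diagonally universal morphism of finite presentation to its codomain. -/
abbrev cod (U : 𝒜 ⥤ ℬ) (B : ℬ) : Basic U B ⥤ ℬ :=
  (isBasic U B).ι ⋙ Under.forget B

/-- The identity of `B`, as a diagonally universal morphism of finite presentation. -/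
def basicId [IsLocallyFinitelyPresentable.{v} ℬ] (U : 𝒜 ⥤ ℬ) (B : ℬ) : Basic U B where
  obj := Under.mk (𝟙 B)
  property := by
    have := Cardinal.fact_isRegular_aleph0
    have (k : Discrete PEmpty.{1}) :
        IsCardinalPresentable ((Functor.empty.{0} ℬ).obj k) Cardinal.aleph0.{v} := k.as.elim
    have : IsFinitelyPresentable.{v} (⊥_ ℬ) :=
      isCardinalPresentable_of_isColimit.{v} _ (colimit.isColimit (Functor.empty.{0} ℬ))
        Cardinal.aleph0 (hasCardinalLT_of_finite _ _ le_rfl)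
    refine ⟨⊥_ ℬ, ⊥_ ℬ, 𝟙 _, initial.to B, initial.to B, this, this, ?_, ?_⟩
    · intro A₁ A₂ a g h w
      refine ⟨g, ⟨by simp, by simpa using w⟩, fun d hd => by simpa using hd.1⟩
    · exact IsPushout.id_vert (initial.to B)

namespace RightMultiadjoint

variable {U : 𝒜 ⥤ ℬ} (M : RightMultiadjoint U)

/-- The factorization order `n ≤ x`: the local unit `x` factorizes through `n`. -/
def Le {B : ℬ} (n : Under B) (x : M.X B) : Prop :=
  ∃ m : n.right ⟶ U.obj (M.obj x), n.hom ≫ m = M.unit x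

/-- `V_x`: the full subcategory of the coslice under `B` consisting of all the diagonally universal
morphisms of finite presentation under `B` through which the local unit `x` factorizes. -/
def V {B : ℬ} (x : M.X B) : ObjectProperty (Under B) := fun n =>
  isBasic U B n ∧ M.Le n x

/-- Diers condition: any local unit `x` under `B` is, in the coslice under `B`, the filtered colimit
of all the diagonally universal morphisms of finite presentation under `B` that factorize it. -/
def DiersCondition : Prop :=
  ∀ {B : ℬ} (x : M.X B),
    IsFiltered (M.V x).FullSubcategory ∧
      ∃ α : (M.V x).ι ⟶ (Functor.const _).obj (Under.mk (M.unit x)),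
        Nonempty (IsColimit (Cocone.mk _ α))

/-! ### The Diers space of an object -/

/-- `D_n`, the set of local units that factorize through `n`. -/
def basicSet {B : ℬ} (n : Under B) : Set (M.X B) := {x | M.Le n x}

/-- The spectral topology, generated by the sets `D_n` for `n` in `𝒟_B`. -/
abbrev spectralTopology (B : ℬ) : TopologicalSpace (M.X B) :=
  generateFrom {s | ∃ n : Basic U B, s = M.basicSet n.obj}

/-- The Diers space of `B`. -/
def diersSpace (B : ℬ) : TopCat.{v} :=
  @TopCat.of (M.X B) (M.spectralTopology B)

/-- `D_n` as an open set of the Diers space. -/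
def basicOpen {B : ℬ} (n : Basic U B) : Opens (M.diersSpace B) where
  carrier := M.basicSet n.obj
  is_open' := isOpen_generateFrom_of_mem ⟨n, rfl⟩

lemma basicOpen_anti {B : ℬ} {n m : Basic U B} (f : n ⟶ m) : M.basicOpen m ≤ M.basicOpen n := by
  rintro x ⟨k, hk⟩
  exact ⟨f.hom.right ≫ k, by rw [← Category.assoc, Under.w, hk]⟩

/-- The functor `D : 𝒟_B ⥤ τ_Bᵒᵖ`. -/
def D (B : ℬ) : Basic U B ⥤ (Opens (M.diersSpace B))ᵒᵖ where
  obj n := op (M.basicOpen n)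
  map f := (homOfLE (M.basicOpen_anti f)).op

/-! ### The structural sheaf -/

/-- The structural sheaf of `B`: the left Kan extension of the codomain functor along
`D : 𝒟_B ⥤ τ_Bᵒᵖ`, followed by sheafification. The data is unique up to unique isomorphism. -/
structure StructuralSheaf (B : ℬ) where
  /-- the structural presheaf -/
  presheaf : (M.diersSpace B).Presheaf ℬ
  /-- the universal natural transformation of the Kan extension -/
  ζ : cod U B ⟶ M.D B ⋙ presheaf
  /-- `presheaf` is the pointwise left Kan extension: its value at `u` is the colimit of `cod n`
  over the `n` with `u ⊆ D_n` -/
  isLan : (Functor.LeftExtension.mk presheaf ζ).IsPointwiseLeftKanExtension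
  /-- the structural sheaf -/
  sheaf : (M.diersSpace B).Presheaf ℬ
  isSheaf : sheaf.IsSheaf
  /-- the unit of the sheafification -/
  γ : presheaf ⟶ sheaf
  /-- `γ` exhibits `sheaf` as the sheafification: morphisms from `presheaf` to a sheaf factorize
  uniquely through `γ` -/
  isSheafification : (Opens.grothendieckTopology (M.diersSpace B)).W γ

namespace StructuralSheaf

variable {M} {B : ℬ} (S : M.StructuralSheaf B)

/-- The map `cod n ⟶ B̃(D_n)`. -/
def sec (n : Basic U B) : n.obj.right ⟶ S.sheaf.obj (op (M.basicOpen n)) :=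
  S.ζ.app n ≫ S.γ.app (op (M.basicOpen n))

variable [IsLocallyFinitelyPresentable.{v} ℬ]

/-- The map `η_B : B ⟶ Γ(B̃)`, given by the identity of `B` in `𝒟_B`, for which `D` is the whole
space. -/
def η : B ⟶ S.sheaf.obj (op ⊤) :=
  S.sec (basicId U B) ≫ S.sheaf.map (homOfLE (fun x _ => ⟨M.unit x, Category.id_comp _⟩)).op

/-- An identification of the stalks of the structural sheaf with the objects of the local units:
at `x` it restricts, for `n ≤ x`, to the maps `cod n ⟶ U A_x` under `B`. -/
structure StalkIdentification where
  iso : ∀ x : M.diersSpace B, S.sheaf.stalk x ≅ U.obj (M.obj (B := B) x)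
  sec_germ_iso : ∀ (n : Basic U B) (x : M.diersSpace B)
    (m : n.obj.right ⟶ U.obj (M.obj (B := B) x)) (hm : n.obj.hom ≫ m = M.unit x),
    S.sec n ≫ S.sheaf.germ (M.basicOpen n) x ⟨m, hm⟩ ≫ (iso x).hom = m

end StructuralSheaf

end RightMultiadjoint

/-! ### `U`-spaces -/

section USpace

variable [IsLocallyFinitelyPresentable.{v} ℬ]

/-- A `U`-space: a space with a sheaf of `ℬ`-objects, and a family of objects of `𝒜` of which the
images under `U` are identified with the stalks. -/
structure USpace (U : 𝒜 ⥤ ℬ) where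
  /-- the space with its sheaf -/
  toSheafedSpace : SheafedSpace.{u, v, v} ℬ
  /-- the family of local objects -/
  localObj : toSheafedSpace → 𝒜
  /-- the identification of the stalks -/
  stalkIso : ∀ x : toSheafedSpace,
    toSheafedSpace.presheaf.stalk x ≅ U.obj (localObj x)

namespace USpace

variable {U : 𝒜 ⥤ ℬ}

/-- A morphism of `U`-spaces `X ⟶ Y`, in the direction of its action on sections: a continuous map
`f` from the space of `Y` to that of `X`, a morphism from the sheaf of `X` to the direct image of the
sheaf of `Y`, and morphisms `localObj (f y) ⟶ localObj y` in `𝒜` of which the images under `U` are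
the induced maps of stalks. -/
structure Hom (X Y : USpace U) where
  /-- the continuous map and the comorphism -/
  toSheafedHom : Y.toSheafedSpace ⟶ X.toSheafedSpace
  /-- the morphisms of local objects -/
  localMap : ∀ y : Y.toSheafedSpace,
    X.localObj (toSheafedHom.hom.base y) ⟶ Y.localObj y
  stalk_comp : ∀ y : Y.toSheafedSpace,
    toSheafedHom.hom.stalkMap y ≫ (Y.stalkIso y).hom =
      (X.stalkIso (toSheafedHom.hom.base y)).hom ≫ U.map (localMap y)

/-- The identity of a `U`-space. -/
def Hom.id (X : USpace U) : Hom X X where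
  toSheafedHom := 𝟙 _
  localMap y := 𝟙 (X.localObj y)
  stalk_comp y := by
    change PresheafedSpace.Hom.stalkMap (𝟙 X.toSheafedSpace.toPresheafedSpace) y ≫ _ = _
    rw [PresheafedSpace.stalkMap.id]
    erw [Category.id_comp, U.map_id, Category.comp_id]
    rfl

/-- The composition of morphisms of `U`-spaces. -/
def Hom.comp {X Y Z : USpace U} (φ : Hom X Y) (ψ : Hom Y Z) : Hom X Z where
  toSheafedHom := ψ.toSheafedHom ≫ φ.toSheafedHom
  localMap z := φ.localMap (ψ.toSheafedHom.hom.base z) ≫ ψ.localMap z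
  stalk_comp z := by
    have h₁ := φ.stalk_comp (ψ.toSheafedHom.hom.base z)
    have h₂ := ψ.stalk_comp z
    have h₃ := PresheafedSpace.stalkMap.comp ψ.toSheafedHom.hom φ.toSheafedHom.hom z
    refine (congrArg (· ≫ (Z.stalkIso z).hom) h₃).trans ?_
    refine (Category.assoc _ _ _).trans ?_
    refine (congrArg (_ ≫ ·) h₂).trans ?_
    refine (Category.assoc _ _ _).symm.trans ?_
    refine (congrArg (· ≫ U.map (ψ.localMap z)) h₁).trans ?_
    refine (Category.assoc _ _ _).trans ?_
    exact congrArg (_ ≫ ·) (U.map_comp _ _).symm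

lemma Hom.ext' {X Y : USpace U} (φ ψ : Hom X Y) (h : φ.toSheafedHom = ψ.toSheafedHom)
    (h' : ∀ y, φ.localMap y = eqToHom (by rw [h]) ≫ ψ.localMap y) : φ = ψ := by
  obtain ⟨f, a, _⟩ := φ
  obtain ⟨g, b, _⟩ := ψ
  obtain rfl : f = g := h
  obtain rfl : a = b := funext fun y => by simpa using h' y
  rfl

/-- The category of `U`-spaces. -/
instance : Category (USpace U) where
  Hom := Hom
  id := Hom.id
  comp := Hom.comp
  id_comp φ := Hom.ext' _ _ (Category.comp_id _) (fun y => by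
    exact (Category.id_comp _).trans (Category.id_comp _).symm)
  comp_id φ := Hom.ext' _ _ (Category.id_comp _) (fun y => by
    exact (Category.comp_id _).trans (Category.id_comp _).symm)
  assoc φ ψ χ := Hom.ext' _ _ (Category.assoc _ _ _).symm (fun y => by
    exact (Category.assoc _ _ _).trans (Category.id_comp _).symm)

/-- The global sections functor. -/
def Γ (U : 𝒜 ⥤ ℬ) : USpace U ⥤ ℬ where
  obj X := X.toSheafedSpace.presheaf.obj (op ⊤)
  map φ := φ.toSheafedHom.hom.c.app (op ⊤)
  map_id _ := rfl
  map_comp _ _ := rfl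

end USpace

end USpace

/-! ### The spectrum -/

namespace RightMultiadjoint

variable [IsLocallyFinitelyPresentable.{v} ℬ] {U : 𝒜 ⥤ ℬ} {M : RightMultiadjoint U}

/-- The `U`-space of local units under `B`, with the spectral topology and the structural sheaf. -/
def StructuralSheaf.toUSpace {B : ℬ} (S : M.StructuralSheaf B) (σ : S.StalkIdentification) :
    USpace U where
  toSheafedSpace := { carrier := M.diersSpace B, presheaf := S.sheaf, IsSheaf := S.isSheaf }
  localObj x := M.obj (B := B) x
  stalkIso := σ.iso

/-- The spectrum functor, with values on objects given by `StructuralSheaf.toUSpace`. -/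
structure Spectrum (S : ∀ B : ℬ, M.StructuralSheaf B) (σ : ∀ B, (S B).StalkIdentification) where
  map : ∀ {B₁ B₂ : ℬ}, (B₁ ⟶ B₂) → ((S B₁).toUSpace (σ B₁) ⟶ (S B₂).toUSpace (σ B₂))
  map_id : ∀ B, map (𝟙 B) = 𝟙 _
  map_comp : ∀ {B₁ B₂ B₃ : ℬ} (f : B₁ ⟶ B₂) (g : B₂ ⟶ B₃), map (f ≫ g) = map f ≫ map g
  /-- on points, `f` acts by sending `x` to the local unit through which `f ≫ unit x` factorizes, and
  the associated map of local objects is the other factor -/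
  unit_comp : ∀ {B₁ B₂ : ℬ} (f : B₁ ⟶ B₂) (x : M.X B₂),
    M.unit (B := B₁) ((map f).toSheafedHom.hom.base x) ≫ U.map ((map f).localMap x) =
      f ≫ M.unit x
  /-- on sections, `f` extends the maps `cod n₁ ⟶ cod n₂` over `f`, for example the canonical map from
  `cod n₁` to its pushout along `f` -/
  sec_comp : ∀ {B₁ B₂ : ℬ} (f : B₁ ⟶ B₂) (n₁ : Basic U B₁) (n₂ : Basic U B₂)
    (h : n₁.obj.right ⟶ n₂.obj.right), n₁.obj.hom ≫ h = f ≫ n₂.obj.hom →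
    ∃ hle : M.basicOpen n₂ ≤
        (Opens.map (map f).toSheafedHom.hom.base).obj (M.basicOpen n₁),
      (S B₁).sec n₁ ≫ (map f).toSheafedHom.hom.c.app (op (M.basicOpen n₁)) ≫
        (S B₂).sheaf.map (homOfLE hle).op = h ≫ (S B₂).sec n₂

/-- The spectrum as a functor. -/
def Spectrum.functor {S : ∀ B : ℬ, M.StructuralSheaf B} {σ : ∀ B, (S B).StalkIdentification}
    (F : M.Spectrum S σ) : ℬ ⥤ USpace U where
  obj B := (S B).toUSpace (σ B)
  map := F.map
  map_id := F.map_id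
  map_comp := F.map_comp

end RightMultiadjoint

end Diers

/-! Everything rests on a rigidity property. An object n of 𝒟_B is finitely presentable among
objects under B and inherits unique diagonal fillers through its pushout square. If m ∘ n = η_x, the
Diers condition factors m through a stage of the colimit by an arrow of V_x, so m is the colimit
injection: factorizations of η_x through n are unique (`DiersCondition.app_eq`). Fillers extend this
to maps into U(A) lying over a local unit (`hom_ext_of_comp`).

Existence of B̃ is a matter of size: 𝒟_B is essentially small, and sheaves are the objects local for
a small set of maps between presentable presheaves, hence reflective. Sheafification preserves
stalks, so the stalk at x is the colimit of cod(n) over x ∈ D_n, which the Diers condition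
identifies with U(A_x).

For the adjunction, let φ : B → F(X) be a map to global sections. Factoring B → F_y ≅ U(A_y) through
a local unit forces the map p on points and the local maps. A map cod(n) → F(w) under B exists iff w
⊆ p⁻¹(D_n), and is then unique: finite presentability spreads germs out, fillers turn germs into
factorizations of local units, and rigidity gives uniqueness, hence gluing (`section_ext`,
`exists_section`). So p is continuous and carries exactly one comorphism with transpose φ.
Functoriality and the formula on sections follow from uniqueness. -/

namespace Diers

/-! ### Locally finitely presentable categories -/

/-- A locally finitely presentable category has a terminal object. -/
lemma hasTerminal_of_lfp (ℬ : Type u) [Category.{v} ℬ] [IsLocallyFinitelyPresentable.{v} ℬ] :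
    HasTerminal ℬ := by
  have := Cardinal.fact_isRegular_aleph0
  let Q := isCardinalPresentable ℬ Cardinal.aleph0.{v}
  have : HasColimitsOfShape Q.FullSubcategory ℬ :=
    hasColimitsOfShape_of_equivalence (equivSmallModel.{v} Q.FullSubcategory).symm
  have hfil : IsCardinalFiltered Q.FullSubcategory Cardinal.aleph0.{v} :=
    { nonempty_cocone := fun {A} _ K hA => ⟨by
        have := isClosedUnderColimitsOfShape_isCardinalPresentable ℬ hA
        exact colimit.cocone K⟩ }
  let T := colimit Q.ι
  -- A map to `T` factors through a stage by a morphism that itself belongs to the diagram, so it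
  -- can only be the colimit injection.
  have hQ (G : Q.FullSubcategory) (f : G.obj ⟶ T) : f = colimit.ι Q.ι G := by
    have : IsCardinalPresentable G.obj Cardinal.aleph0.{v} := G.property
    obtain ⟨j, g, hg⟩ := IsCardinalPresentable.exists_hom_of_isColimit Cardinal.aleph0.{v}
      (colimit.isColimit Q.ι) f
    rw [← hg]
    exact colimit.w Q.ι (ObjectProperty.homMk g : G ⟶ j)
  obtain ⟨P, _, hP⟩ := HasCardinalFilteredGenerator.exists_generator ℬ Cardinal.aleph0.{v}
  have hX (X : ℬ) : Nonempty (Unique (X ⟶ T)) := by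
    obtain ⟨J, _, _, ⟨p⟩⟩ := hP.exists_colimitsOfShape X
    let G (j : J) : Q.FullSubcategory :=
      ⟨p.diag.obj j, hP.le_isCardinalPresentable _ (p.prop_diag_obj j)⟩
    refine ⟨⟨⟨p.isColimit.desc (Cocone.mk T
      { app := fun j => colimit.ι Q.ι (G j)
        naturality := fun i j f => ?_ })⟩, fun f => p.isColimit.hom_ext fun j => ?_⟩⟩
    · exact (hQ (G i) _).trans (Category.comp_id _).symm
    · exact (hQ (G j) _).trans (hQ (G j) _).symm
  exact (IsTerminal.ofUniqueHom (Y := T) (fun X => (hX X).some.default)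
    (fun X f => (hX X).some.uniq f)).hasTerminal

/-! ### Sheafification with values in a locally finitely presentable category -/

/-- Presheaves with values in a locally finitely presentable category are sheaves if the presheaves
of sections on the objects of a generator are. -/
lemma isSheaf_of_generator {C : Type v} [SmallCategory C] (J : GrothendieckTopology C)
    {ℬ : Type u} [Category.{v} ℬ] {P : ObjectProperty ℬ} (hP : ∀ X : ℬ, ∃ (K : Type v)
      (_ : SmallCategory K), Nonempty (P.ColimitOfShape K X)) (F : Cᵒᵖ ⥤ ℬ)
    (hF : ∀ M : ℬ, P M → Presieve.IsSheaf J (F ⋙ coyoneda.obj (op M))) :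
    Presheaf.IsSheaf J F := by
  intro E X S hS x hx
  obtain ⟨K, _, ⟨p⟩⟩ := hP E
  let y (k : K) : Presieve.FamilyOfElements (F ⋙ coyoneda.obj (op (p.diag.obj k))) S.arrows :=
    fun Y f hf => p.ι.app k ≫ x f hf
  have hy (k : K) : (y k).Compatible := fun Y₁ Y₂ Z g₁ g₂ f₁ f₂ h₁ h₂ w => by
    have := hx g₁ g₂ h₁ h₂ w
    dsimp [y] at this ⊢
    rw [Category.assoc, Category.assoc, this]
  choose t ht ht' using fun k => hF _ (p.prop_diag_obj k) S hS (y k) (hy k)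
  have ht_eq {k : K} (s : p.diag.obj k ⟶ F.obj (op X))
      (hs : ∀ ⦃Y⦄ (f : Y ⟶ X) (hf : S f), s ≫ F.map f.op = p.ι.app k ≫ x f hf) : s = t k :=
    ht' k s hs
  -- Amalgamations are unique, so the `t k` are compatible with the transition maps.
  let c : Cocone p.diag := Cocone.mk (F.obj (op X))
    { app := t
      naturality := fun i j f => by
        refine (ht_eq _ fun Y g hg => ?_).trans (Category.comp_id _).symm
        have h₁ : t j ≫ F.map g.op = p.ι.app j ≫ x g hg := ht j g hg
        have h₂ := p.ι.naturality f
        simp only [Functor.const_obj_map, Category.comp_id, Functor.const_obj_obj] at h₂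
        rw [Category.assoc, h₁, reassoc_of% h₂] }
  have hc (k : K) : p.ι.app k ≫ p.isColimit.desc c = t k := p.isColimit.fac c k
  refine ⟨p.isColimit.desc c, fun Y g hg => p.isColimit.hom_ext fun k => ?_,
    fun s hs => p.isColimit.hom_ext fun k => ?_⟩
  · refine Eq.trans ?_ (ht k g hg)
    rw [← hc]
    exact (Category.assoc _ _ _).symm
  · refine Eq.trans (ht_eq _ fun Y g hg => ?_) (hc k).symm
    exact (Category.assoc _ _ _).trans (congrArg (p.ι.app k ≫ ·) (hs g hg))

lemma exists_regular_cardinal_ge {ι : Type u} [Small.{v} ι]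
    (κ : ι → Cardinal.{v}) : ∃ κ' : Cardinal.{v}, κ'.IsRegular ∧ ∀ i, κ i ≤ κ' := by
  obtain ⟨κ', h, h'⟩ := HasCardinalLT.exists_regular_cardinal_forall.{v} (fun i => (κ i).ord.ToType)
  refine ⟨κ', h, fun i => le_of_lt ?_⟩
  simpa [hasCardinalLT_iff_cardinal_mk_lt] using h' i

/-- Presheaves on a small site with values in a locally finitely presentable category have a
sheafification. -/
lemma hasWeakSheafify_of_lfp {C : Type v} [SmallCategory C] (J : GrothendieckTopology C)
    (ℬ : Type u) [Category.{v} ℬ] [IsLocallyFinitelyPresentable.{v} ℬ] : HasWeakSheafify J ℬ := by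
  have := Cardinal.fact_isRegular_aleph0
  obtain ⟨P, _, hP⟩ := HasCardinalFilteredGenerator.exists_small_generator ℬ Cardinal.aleph0.{v}
  let L (M : ℬ) : (Cᵒᵖ ⥤ Type v) ⥤ (Cᵒᵖ ⥤ ℬ) :=
    (Functor.whiskeringRight _ _ _).obj (sigmaConst.obj M)
  let R (M : ℬ) : (Cᵒᵖ ⥤ ℬ) ⥤ (Cᵒᵖ ⥤ Type v) :=
    (Functor.whiskeringRight _ _ _).obj (coyoneda.obj (op M))
  let adj (M : ℬ) : L M ⊣ R M := (sigmaConstAdj M).whiskerRight _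
  let ι := (Σ X : C, Subtype (fun S : Sieve X => S ∈ J X)) × Subtype P
  -- By the copower adjunction, locality for these maps is the sheaf condition on Hom(M, F(-)) for
  -- `M` in the generator.
  let W : MorphismProperty (Cᵒᵖ ⥤ ℬ) := MorphismProperty.ofHoms
    (fun i : ι => (L i.2.1).map i.1.2.1.functorInclusion)
  have hW : W.isLocal = Presheaf.IsSheaf J := by
    have key (X : C) (S : Sieve X) (M : ℬ) (F : Cᵒᵖ ⥤ ℬ) :
        (Function.Bijective fun g : (L M).obj (yoneda.obj X) ⟶ F =>
          (L M).map S.functorInclusion ≫ g) ↔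
          Presieve.IsSheafFor (F ⋙ coyoneda.obj (op M)) S.arrows := by
      rw [Adjunction.map_comp_bijective_iff (adj M), Function.bijective_iff_existsUnique,
        Presieve.isSheafFor_iff_yonedaSheafCondition]
      rfl
    ext F
    refine ⟨fun hF => isSheaf_of_generator (P := P) J (fun X => ?_) F fun M hM X S hS => ?_,
      fun hF => ?_⟩
    · obtain ⟨K, _, _, h⟩ := hP.exists_colimitsOfShape X
      exact ⟨K, inferInstance, h⟩
    · exact (key X S M F).1 (hF _ ⟨(⟨⟨X, S, hS⟩, M, hM⟩ : ι)⟩)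
    · rintro _ _ _ ⟨⟨X, S, hS⟩, M, hM⟩
      exact (key X S M F).2 (hF M S hS)
  have : W.isLocal.ι.IsRightAdjoint := by
    have hpres (G : Cᵒᵖ ⥤ Type v) : ∃ (κ : Cardinal.{v}) (_ : Fact κ.IsRegular),
        IsCardinalPresentable G κ := (inferInstance : IsPresentable.{v} G).exists_cardinal
    choose κ hκ hκ' using hpres
    -- One cardinal serves the generator (via ℵ₀), the representables and the sieves.
    obtain ⟨κ', h₁, h₂⟩ := exists_regular_cardinal_ge.{v}
      (Sum.elim (fun _ : Unit => Cardinal.aleph0)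
        (Sum.elim (fun X : C => κ (yoneda.obj X))
          (fun i : (Σ X : C, Sieve X) => κ i.2.functor)))
    have : Fact κ'.IsRegular := ⟨h₁⟩
    refine MorphismProperty.isRightAdjoint_ι_isLocal W κ' ?_
    rintro _ _ _ ⟨⟨X, S, hS⟩, M, hM⟩
    have : IsCardinalPresentable M Cardinal.aleph0.{v} := hP.le_isCardinalPresentable _ hM
    have : IsCardinalPresentable M κ' :=
      isCardinalPresentable_of_le M (κ := Cardinal.aleph0) (h₂ (Sum.inl ⟨⟩))
    have := hκ' S.functor
    have := isCardinalPresentable_of_le S.functor (κ := κ S.functor)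
      (h₂ (Sum.inr (Sum.inr ⟨X, S⟩)))
    have := hκ' (yoneda.obj X)
    have := isCardinalPresentable_of_le (yoneda.obj X) (κ := κ (yoneda.obj X))
      (h₂ (Sum.inr (Sum.inl X)))
    -- A left adjoint preserves κ'-presentable objects when its right adjoint preserves κ'-filtered
    -- colimits.
    have : (R M).IsCardinalAccessible κ' :=
      ⟨fun J _ _ => by
        have := preservesColimitsOfShape_of_isCardinalPresentable M κ' J
        infer_instance⟩
    exact ⟨(adj M).isCardinalPresentable_leftAdjoint_obj κ' _,
      (adj M).isCardinalPresentable_leftAdjoint_obj κ' _⟩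
  rw [hW] at this
  exact this

end Diers

namespace Diers

variable {𝒜 : Type u₁} [Category.{v₁} 𝒜] {ℬ : Type u} [Category.{v} ℬ]

/-! ### Diagonally universal morphisms of finite presentation -/

section

variable [IsLocallyFinitelyPresentable.{v} ℬ]

/-- A pushout depends, up to isomorphism, only on its span, and finitely presentable objects have a
small set of representatives. -/
instance essentiallySmall_isBasic (U : 𝒜 ⥤ ℬ) (B : ℬ) :
    ObjectProperty.EssentiallySmall.{v} (isBasic U B) := by
  have := Cardinal.fact_isRegular_aleph0
  obtain ⟨Q, _, -, hQ⟩ := ObjectProperty.EssentiallySmall.exists_small_le.{v}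
    (isCardinalPresentable ℬ Cardinal.aleph0.{v})
  let ι := Σ (K L : Subtype Q), (K.1 ⟶ L.1) × (K.1 ⟶ B)
  refine ⟨.ofObj fun i : ι => Under.mk (pushout.inl i.2.2.2 i.2.2.1), inferInstance, ?_⟩
  rintro n ⟨K, L, k, g, h, hK, hL, -, hp⟩
  obtain ⟨K', hK', ⟨e⟩⟩ := hQ _ hK
  obtain ⟨L', hL', ⟨e'⟩⟩ := hQ _ hL
  have hp' : IsPushout (e.inv ≫ g) (e.inv ≫ k ≫ e'.hom) n.hom (e'.inv ≫ h) :=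
    hp.of_iso e (Iso.refl _) e' (Iso.refl _) (by simp) (by simp) (by simp) (by simp)
  exact ⟨_, ⟨(⟨⟨K', hK'⟩, ⟨L', hL'⟩, e.inv ≫ k ≫ e'.hom, e.inv ≫ g⟩ : ι)⟩,
    ⟨Under.isoMk hp'.isoPushout (by simp)⟩⟩

instance {U : 𝒜 ⥤ ℬ} (M : RightMultiadjoint U) {B : ℬ} (x : M.X B) :
    ObjectProperty.EssentiallySmall.{v} (M.V x) :=
  .of_le (Q := isBasic U B) fun _ h => h.1

lemma RightMultiadjoint.nonempty_structuralSheaf {U : 𝒜 ⥤ ℬ} (M : RightMultiadjoint U) (B : ℬ) :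
    Nonempty (M.StructuralSheaf B) := by
  have (u : (Opens (M.diersSpace B))ᵒᵖ) : HasColimitsOfShape (CostructuredArrow (M.D B) u) ℬ :=
    hasColimitsOfShape_of_equivalence (equivSmallModel.{v} _).symm
  have : (M.D B).HasPointwiseLeftKanExtension (cod U B) := fun _ => inferInstance
  have := hasWeakSheafify_of_lfp (Opens.grothendieckTopology (M.diersSpace B)) ℬ
  let F := (M.D B).pointwiseLeftKanExtension (cod U B)
  exact ⟨{
    presheaf := F
    ζ := _
    isLan := (M.D B).pointwiseLeftKanExtensionIsPointwiseLeftKanExtension (cod U B)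
    sheaf := sheafify (Opens.grothendieckTopology (M.diersSpace B)) F
    isSheaf := ((presheafToSheaf _ ℬ).obj F).property
    γ := toSheafify _ F
    isSheafification := GrothendieckTopology.W_toSheafify _ _ }⟩

end

/-- Orthogonality passes to pushouts: the filler for `k` is glued with `g`. -/
lemma isBasic.existsUnique_lift {U : 𝒜 ⥤ ℬ} {B : ℬ} {n : Under B} (hn : isBasic U B n)
    {A₁ A₂ : 𝒜} (a : A₁ ⟶ A₂) (g : B ⟶ U.obj A₁) (h : n.right ⟶ U.obj A₂)
    (w : g ≫ U.map a = n.hom ≫ h) :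
    ∃! d : n.right ⟶ U.obj A₁, n.hom ≫ d = g ∧ d ≫ U.map a = h := by
  obtain ⟨K, L, k, r, s, -, -, hk, hp⟩ := hn
  obtain ⟨d, ⟨hd₁, hd₂⟩, hd⟩ := hk a (r ≫ g) (s ≫ h) (by
    rw [Category.assoc, w, reassoc_of% hp.w])
  refine ⟨hp.desc g d hd₁.symm, ⟨hp.inl_desc _ _ _, ?_⟩, ?_⟩
  · refine hp.hom_ext ?_ ?_
    · rw [hp.inl_desc_assoc, w]
    · rw [hp.inr_desc_assoc, hd₂]
  · rintro e ⟨he₁, he₂⟩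
    refine hp.hom_ext ?_ ?_
    · rw [hp.inl_desc, he₁]
    · rw [hp.inr_desc]
      refine hd _ ⟨?_, ?_⟩
      · rw [← he₁, reassoc_of% hp.w]
      · rw [Category.assoc, he₂]

/-- A diagonally universal morphism of finite presentation `n` under `B` is finitely presentable
with respect to filtered diagrams under `B`. -/
lemma isBasic.exists_hom_of_isColimit {U : 𝒜 ⥤ ℬ} {B : ℬ} {n : Under B} (hn : isBasic U B n)
    {J : Type*} [Category* J] [EssentiallySmall.{v} J] [IsFiltered J] {D : J ⥤ ℬ} {c : Cocone D}
    (hc : IsColimit c) (s : (Functor.const J).obj B ⟶ D) (f : n.right ⟶ c.pt)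
    (h : ∀ j, s.app j ≫ c.ι.app j = n.hom ≫ f) :
    ∃ (j : J) (q : n.right ⟶ D.obj j), n.hom ≫ q = s.app j ∧ q ≫ c.ι.app j = f := by
  have := Cardinal.fact_isRegular_aleph0
  have : IsCardinalFiltered J Cardinal.aleph0.{v} := by rwa [isCardinalFiltered_aleph0_iff]
  obtain ⟨K, L, k, g, l, hK, hL, -, hp⟩ := hn
  obtain ⟨j, q, hq⟩ := IsCardinalPresentable.exists_hom_of_isColimit Cardinal.aleph0.{v} hc (l ≫ f)
  -- The two maps from `K` agree only in the colimit; finite presentability of `K` makes them agree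
  -- at a later stage, where the pushout can be mapped out.
  obtain ⟨i, a, ha⟩ := IsCardinalPresentable.exists_eq_of_isColimit' Cardinal.aleph0.{v} hc
    (k ≫ q) (g ≫ s.app j) (by rw [Category.assoc, hq, Category.assoc, h, reassoc_of% hp.w])
  have hs : s.app j ≫ D.map a = s.app i := by simpa using (s.naturality a).symm
  refine ⟨i, hp.desc (s.app i) (q ≫ D.map a) ?_, hp.inl_desc _ _ _, hp.hom_ext ?_ ?_⟩
  · rw [← hs, ← Category.assoc, ← ha, Category.assoc]
  · rw [hp.inl_desc_assoc, h]
  · rw [hp.inr_desc_assoc, Category.assoc, c.w, hq]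

/-- Maps agreeing on `B` need only be compared on `L`. -/
lemma isBasic.exists_eq_of_isColimit {U : 𝒜 ⥤ ℬ} {B : ℬ} {n : Under B} (hn : isBasic U B n)
    {J : Type*} [Category* J] [EssentiallySmall.{v} J] [IsFiltered J] {D : J ⥤ ℬ} {c : Cocone D}
    (hc : IsColimit c) {j : J} (f₁ f₂ : n.right ⟶ D.obj j) (hf : n.hom ≫ f₁ = n.hom ≫ f₂)
    (h : f₁ ≫ c.ι.app j = f₂ ≫ c.ι.app j) :
    ∃ (i : J) (a : j ⟶ i), f₁ ≫ D.map a = f₂ ≫ D.map a := by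
  have := Cardinal.fact_isRegular_aleph0
  have : IsCardinalFiltered J Cardinal.aleph0.{v} := by rwa [isCardinalFiltered_aleph0_iff]
  obtain ⟨K, L, k, g, l, hK, hL, -, hp⟩ := hn
  obtain ⟨i, a, ha⟩ := IsCardinalPresentable.exists_eq_of_isColimit' Cardinal.aleph0.{v} hc
    (l ≫ f₁) (l ≫ f₂) (by rw [Category.assoc, h, Category.assoc])
  refine ⟨i, a, hp.hom_ext ?_ ?_⟩
  · rw [reassoc_of% hf]
  · simpa using ha

end Diers

namespace Diers

variable {𝒜 : Type u₁} [Category.{v₁} 𝒜] {ℬ : Type u} [Category.{v} ℬ]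

/-! ### Stalks of the structural sheaf -/

/-- Morphisms of presheaves which become isomorphisms after sheafification are isomorphisms on the
stalks. -/
lemma exists_stalk_iso [HasColimits ℬ] [HasTerminal ℬ] {X : TopCat.{v}}
    {F G : X.Presheaf ℬ} (γ : F ⟶ G) (hγ : (Opens.grothendieckTopology X).W γ) (x : X) :
    ∃ i : F.stalk x ≅ G.stalk x, ∀ (u : Opens X) (hx : x ∈ u),
      F.germ u x hx ≫ i.hom = γ.app (op u) ≫ G.germ u x hx := by
  classical
  -- The stalk functor is left adjoint to skyscrapers, which are sheaves and exist because there is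
  -- a terminal object.
  have : IsIso ((TopCat.Presheaf.stalkFunctor ℬ x).map γ) := by
    rw [isIso_iff_coyoneda_map_bijective]
    intro T
    exact ((skyscraperPresheafStalkAdjunction x).map_comp_bijective_iff γ T).2
      (hγ _ (skyscraperPresheaf_isSheaf x T))
  let i := asIso ((TopCat.Presheaf.stalkFunctor ℬ x).map γ)
  exact ⟨i, fun u hx => TopCat.Presheaf.stalkFunctor_map_germ u x hx γ⟩

variable {U : 𝒜 ⥤ ℬ} {M : RightMultiadjoint U}

namespace RightMultiadjoint

lemma DiersCondition.exists_isColimit (hM : M.DiersCondition) {B : ℬ} (x : M.X B) :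
    ∃ α : (M.V x).ι ⋙ Under.forget B ⟶ (Functor.const _).obj (U.obj (M.obj x)),
      (∀ n, n.obj.hom ≫ α.app n = M.unit x) ∧ Nonempty (IsColimit (Cocone.mk _ α)) := by
  obtain ⟨_, α, ⟨hα⟩⟩ := hM x
  exact ⟨Functor.whiskerRight α (Under.forget B), fun n => Under.w (α.app n),
    ⟨isColimitOfPreserves (Under.forget B) hα⟩⟩

section

variable [IsLocallyFinitelyPresentable.{v} ℬ]

/-- Finite presentability of `n` under `B` factors `m` through a stage `j`; the factor is an arrow
of `V_x`, and naturality of `α` along it concludes. -/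
lemma DiersCondition.app_eq (hM : M.DiersCondition) {B : ℬ} {x : M.X B}
    {α : (M.V x).ι ⋙ Under.forget B ⟶ (Functor.const _).obj (U.obj (M.obj x))}
    (hα : ∀ n, n.obj.hom ≫ α.app n = M.unit x) (hc : IsColimit (Cocone.mk _ α))
    (n : (M.V x).FullSubcategory) (m : n.obj.right ⟶ U.obj (M.obj x))
    (hm : n.obj.hom ≫ m = M.unit x) : α.app n = m := by
  have := (hM x).1
  obtain ⟨j, q, hq, hq'⟩ := n.property.1.exists_hom_of_isColimit hc
    { app := fun j => j.obj.hom, naturality := fun i j f => by simp } m (fun j => by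
      exact (hα j).trans hm.symm)
  have := α.naturality (ObjectProperty.homMk (Under.homMk q hq) : n ⟶ j)
  refine Eq.trans ?_ hq'
  refine Eq.trans ?_ this.symm
  exact (Category.comp_id _).symm

lemma DiersCondition.hom_ext (hM : M.DiersCondition) {B : ℬ} {x : M.X B} {n : Under B}
    (hn : isBasic U B n) {m m' : n.right ⟶ U.obj (M.obj x)} (hm : n.hom ≫ m = M.unit x)
    (hm' : n.hom ≫ m' = M.unit x) : m = m' := by
  obtain ⟨α, hα, ⟨hc⟩⟩ := hM.exists_isColimit x
  let n' : (M.V x).FullSubcategory := ⟨n, hn, m, hm⟩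
  rw [← hM.app_eq hα hc n' m hm, ← hM.app_eq hα hc n' m' hm']

/-- Morphisms from `cod n` to `U A` under `B` which lie over a given local unit are unique. -/
lemma DiersCondition.hom_ext_of_comp (hM : M.DiersCondition) {B : ℬ} {x : M.X B} {n : Under B}
    (hn : isBasic U B n) {A : 𝒜} (a : M.obj x ⟶ A) {m m' : n.right ⟶ U.obj A}
    (hm : n.hom ≫ m = M.unit x ≫ U.map a) (hm' : n.hom ≫ m' = M.unit x ≫ U.map a) : m = m' := by
  obtain ⟨d, ⟨hd, rfl⟩, -⟩ := hn.existsUnique_lift a _ _ hm.symm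
  obtain ⟨d', ⟨hd', rfl⟩, -⟩ := hn.existsUnique_lift a _ _ hm'.symm
  rw [hM.hom_ext hn hd hd']

end

namespace StructuralSheaf

variable {B : ℬ} (S : M.StructuralSheaf B)

/-- The map `cod n ⟶ B̄(D_n)` to the sections of the structural presheaf. -/
def presec (n : Basic U B) : n.obj.right ⟶ S.presheaf.obj (op (M.basicOpen n)) :=
  S.ζ.app n

lemma sec_eq (n : Basic U B) : S.sec n = S.presec n ≫ S.γ.app (op (M.basicOpen n)) := rfl

lemma presec_map {n m : Basic U B} (f : n ⟶ m) (h : M.basicOpen m ≤ M.basicOpen n) :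
    S.presec n ≫ S.presheaf.map (homOfLE h).op = f.hom.right ≫ S.presec m :=
  (S.ζ.naturality f).symm

lemma sec_map {n m : Basic U B} (f : n ⟶ m) (h : M.basicOpen m ≤ M.basicOpen n) :
    S.sec n ≫ S.sheaf.map (homOfLE h).op = f.hom.right ≫ S.sec m := by
  rw [sec_eq, sec_eq, Category.assoc, ← S.γ.naturality, ← Category.assoc, ← Category.assoc,
    S.presec_map f h]

lemma presheaf_obj_hom_ext {u : Opens (M.diersSpace B)} {T : ℬ}
    {f g : S.presheaf.obj (op u) ⟶ T}
    (h : ∀ (n : Basic U B) (k : u ⟶ M.basicOpen n),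
      S.presec n ≫ S.presheaf.map k.op ≫ f = S.presec n ≫ S.presheaf.map k.op ≫ g) : f = g := by
  refine (S.isLan (op u)).hom_ext fun j => ?_
  have := h j.left j.hom.unop
  exact (Category.assoc _ _ _).trans (this.trans (Category.assoc _ _ _).symm)

/-- The structural presheaf is the left Kan extension: morphisms from `B̄(u)` are given by compatible
families of morphisms from `cod n` for `u ⊆ D_n`. -/
lemma presheaf_obj_exists_desc {u : Opens (M.diersSpace B)} {T : ℬ}
    (t : ∀ (n : Basic U B), u ≤ M.basicOpen n → (n.obj.right ⟶ T))
    (ht : ∀ (n m : Basic U B) (hn : u ≤ M.basicOpen n) (hm : u ≤ M.basicOpen m) (f : n ⟶ m),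
      f.hom.right ≫ t m hm = t n hn) :
    ∃ d : S.presheaf.obj (op u) ⟶ T, ∀ (n : Basic U B) (k : u ⟶ M.basicOpen n),
      S.presec n ≫ S.presheaf.map k.op ≫ d = t n (leOfHom k) := by
  let c : Cocone (CostructuredArrow.proj (M.D B) (op u) ⋙ cod U B) :=
    { pt := T
      ι :=
        { app := fun j => t j.left (leOfHom j.hom.unop)
          naturality := fun i j f =>
            (ht i.left j.left _ _ f.left).trans (Category.comp_id _).symm } }
  refine ⟨(S.isLan (op u)).desc c, fun n k => ?_⟩
  have := (S.isLan (op u)).fac c (CostructuredArrow.mk (Y := n) (S := M.D B) k.op)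
  exact (Category.assoc _ _ _).symm.trans this

variable [IsLocallyFinitelyPresentable.{v} ℬ]

/-- Morphisms from the stalk at `x` of the structural presheaf are given by compatible families of
morphisms from `cod n` for `n ≤ x`. -/
lemma presheaf_stalk_exists_desc {x : M.diersSpace B} {T : ℬ}
    (t : ∀ n : Basic U B, x ∈ M.basicOpen n → (n.obj.right ⟶ T))
    (ht : ∀ (n m : Basic U B) (hn : x ∈ M.basicOpen n) (hm : x ∈ M.basicOpen m) (f : n ⟶ m),
      f.hom.right ≫ t m hm = t n hn) :
    ∃ d : S.presheaf.stalk x ⟶ T, ∀ (n : Basic U B) (hx : x ∈ M.basicOpen n),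
      S.presec n ≫ S.presheaf.germ _ x hx ≫ d = t n hx := by
  choose d hd using fun (u : Opens (M.diersSpace B)) (hx : x ∈ u) =>
    S.presheaf_obj_exists_desc (u := u) (fun n hu => t n (hu hx))
      (fun n m hn hm f => ht n m (hn hx) (hm hx) f)
  have hd' {u w : Opens (M.diersSpace B)} (i : u ⟶ w) (hu : x ∈ u) (hw : x ∈ w) :
      S.presheaf.map i.op ≫ d u hu = d w hw := by
    refine S.presheaf_obj_hom_ext fun n k => ?_
    rw [hd w hw n k, ← hd u hu n (i ≫ k), op_comp, Functor.map_comp, Category.assoc]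
  let e : S.presheaf.stalk x ⟶ T := colimit.desc _ (Cocone.mk T
    { app := fun u => d u.unop.1 u.unop.2
      naturality := fun u w f =>
        (hd' ((OpenNhds.inclusion x).map f.unop) _ _).trans (Category.comp_id _).symm })
  have he (u) (hx : x ∈ u) : S.presheaf.germ u x hx ≫ e = d u hx := colimit.ι_desc _ _
  refine ⟨e, fun n hx => ?_⟩
  simpa [he] using hd _ hx n (𝟙 _)

lemma presheaf_stalk_hom_ext {x : M.diersSpace B} {T : ℬ} {f g : S.presheaf.stalk x ⟶ T}
    (h : ∀ (n : Basic U B) (hx : x ∈ M.basicOpen n),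
      S.presec n ≫ S.presheaf.germ _ x hx ≫ f = S.presec n ≫ S.presheaf.germ _ x hx ≫ g) :
    f = g := by
  refine S.presheaf.stalk_hom_ext fun u hu => S.presheaf_obj_hom_ext fun n k => ?_
  rw [TopCat.Presheaf.germ_res_assoc, TopCat.Presheaf.germ_res_assoc]
  exact h n _

/-- Morphisms from the stalk at `x` of the structural sheaf are given by compatible families of
morphisms from `cod n` for `n ≤ x`. -/
lemma stalk_exists_desc {x : M.diersSpace B} {T : ℬ}
    (t : ∀ n : Basic U B, x ∈ M.basicOpen n → (n.obj.right ⟶ T))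
    (ht : ∀ (n m : Basic U B) (hn : x ∈ M.basicOpen n) (hm : x ∈ M.basicOpen m) (f : n ⟶ m),
      f.hom.right ≫ t m hm = t n hn) :
    ∃ d : S.sheaf.stalk x ⟶ T, ∀ (n : Basic U B) (hx : x ∈ M.basicOpen n),
      S.sec n ≫ S.sheaf.germ _ x hx ≫ d = t n hx := by
  have := hasTerminal_of_lfp ℬ
  obtain ⟨i, hi⟩ := exists_stalk_iso S.γ S.isSheafification x
  obtain ⟨d, hd⟩ := S.presheaf_stalk_exists_desc t ht
  refine ⟨i.inv ≫ d, fun n hx => ?_⟩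
  rw [sec_eq, Category.assoc, ← reassoc_of% hi, i.hom_inv_id_assoc, hd]

/-- Morphisms from a stalk of the structural sheaf are determined by their restrictions to `cod n` for
`n ≤ x`. -/
lemma stalk_hom_ext {x : M.diersSpace B} {T : ℬ} {f g : S.sheaf.stalk x ⟶ T}
    (h : ∀ (n : Basic U B) (hx : x ∈ M.basicOpen n),
      S.sec n ≫ S.sheaf.germ _ x hx ≫ f = S.sec n ≫ S.sheaf.germ _ x hx ≫ g) : f = g := by
  have := hasTerminal_of_lfp ℬ
  obtain ⟨i, hi⟩ := exists_stalk_iso S.γ S.isSheafification x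
  refine (cancel_epi i.hom).1 ?_
  refine S.presheaf_stalk_hom_ext fun n hx => ?_
  rw [reassoc_of% hi, reassoc_of% hi]
  have := h n hx
  rwa [sec_eq, Category.assoc, Category.assoc] at this

lemma sec_germ {n m : Basic U B} (f : n ⟶ m) {x : M.diersSpace B} (hn : x ∈ M.basicOpen n)
    (hm : x ∈ M.basicOpen m) :
    f.hom.right ≫ S.sec m ≫ S.sheaf.germ _ x hm = S.sec n ≫ S.sheaf.germ _ x hn := by
  rw [← Category.assoc, ← S.sec_map f (M.basicOpen_anti f), Category.assoc,
    TopCat.Presheaf.germ_res]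

/-- Under the Diers condition, the stalk at `x` of the structural sheaf is `U A_x`. -/
lemma nonempty_stalkIdentification (hM : M.DiersCondition) : Nonempty S.StalkIdentification := by
  have key (x : M.X B) : ∃ i : S.sheaf.stalk (X := M.diersSpace B) x ≅ U.obj (M.obj x),
      ∀ (n : Basic U B) (m : n.obj.right ⟶ U.obj (M.obj x)) (hm : n.obj.hom ≫ m = M.unit x),
        S.sec n ≫ S.sheaf.germ (M.basicOpen n) x ⟨m, hm⟩ ≫ i.hom = m := by
    obtain ⟨α, hα, ⟨hc⟩⟩ := hM.exists_isColimit x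
    let toV (n : Basic U B) (hx : M.Le n.obj x) : (M.V x).FullSubcategory :=
      ⟨n.obj, n.property, hx⟩
    -- Since x ∈ D_n means n ∈ V_x, the stalk and `U A_x` are colimits of the same diagram; `d` and
    -- `hc.desc c` are the comparison maps.
    obtain ⟨d, hd⟩ := S.stalk_exists_desc (x := x) (fun n hx => α.app (toV n hx))
      (fun n m hn hm f => (α.naturality (ObjectProperty.homMk f.hom : toV n hn ⟶ toV m hm)).trans
        (Category.comp_id _))
    let c : Cocone ((M.V x).ι ⋙ Under.forget B) := Cocone.mk (S.sheaf.stalk (X := M.diersSpace B) x)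
      { app := fun n => S.sec ⟨n.obj, n.property.1⟩ ≫
          S.sheaf.germ (X := M.diersSpace B) (M.basicOpen ⟨n.obj, n.property.1⟩) x n.property.2
        naturality := fun n m f => (S.sec_germ (n := ⟨n.obj, n.property.1⟩)
          (m := ⟨m.obj, m.property.1⟩) (ObjectProperty.homMk f.hom) n.property.2
            m.property.2).trans (Category.comp_id _).symm }
    have hd₁ (n : (M.V x).FullSubcategory) : α.app n ≫ hc.desc c = c.ι.app n := hc.fac c n
    have hd₂ (n : (M.V x).FullSubcategory) : c.ι.app n ≫ d = α.app n :=
      (Category.assoc _ _ _).trans (hd ⟨n.obj, n.property.1⟩ n.property.2)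
    refine ⟨⟨d, hc.desc c, ?_, ?_⟩, fun n m hm => (hd n ⟨m, hm⟩).trans
      (hM.app_eq hα hc (toV n ⟨m, hm⟩) m hm)⟩
    · refine S.stalk_hom_ext fun n hx => ?_
      have h₁ := hd₁ (toV n hx)
      rw [← hd₂ (toV n hx)] at h₁
      exact (by simpa [c] using h₁)
    · refine hc.hom_ext fun n => ?_
      have h₂ := hd₂ n
      rw [← hd₁ n] at h₂
      exact (Category.assoc _ _ _).symm.trans (h₂.trans (Category.comp_id _).symm)
  choose i hi using key
  exact ⟨⟨i, fun n x m hm => hi x n m hm⟩⟩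

end StructuralSheaf

end RightMultiadjoint

end Diers

namespace Diers

/-! ### Sheaves with values in a category -/

section

variable {ℬ : Type u} [Category.{v} ℬ] {X : TopCat.{v}} {F : X.Presheaf ℬ}

/-- The sheaf of types of morphisms from an object to the sections of a sheaf. -/
def homSheaf (hF : F.IsSheaf) (E : ℬ) : TopCat.Sheaf (Type v) X :=
  ⟨F ⋙ coyoneda.obj (op E), (isSheaf_iff_isSheaf_of_type _ _).2 (hF E)⟩

lemma sheaf_hom_ext (hF : F.IsSheaf) {E : ℬ} {w : Opens X} {s t : E ⟶ F.obj (op w)}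
    (h : ∀ z ∈ w, ∃ (u : Opens X) (_ : z ∈ u) (k : u ⟶ w), s ≫ F.map k.op = t ≫ F.map k.op) :
    s = t := by
  choose u hu k hk using fun z : w => h z.1 z.2
  exact (homSheaf hF E).eq_of_locally_eq' u w k
    (fun z hz => Opens.mem_iSup.2 ⟨⟨z, hz⟩, hu _⟩) s t hk

lemma sheaf_exists_gluing (hF : F.IsSheaf) {E : ℬ} {w : Opens X} (u : w → Opens X)
    (hu : ∀ z, z.1 ∈ u z) (k : ∀ z, u z ⟶ w) (s : ∀ z, E ⟶ F.obj (op (u z)))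
    (hs : ∀ z z', s z ≫ F.map (homOfLE (inf_le_left : u z ⊓ u z' ≤ u z)).op =
      s z' ≫ F.map (homOfLE (inf_le_right : u z ⊓ u z' ≤ u z')).op) :
    ∃ t : E ⟶ F.obj (op w), ∀ z, t ≫ F.map (k z).op = s z := by
  obtain ⟨t, ht, -⟩ := (homSheaf hF E).existsUnique_gluing' u w k
    (fun z hz => Opens.mem_iSup.2 ⟨⟨z, hz⟩, hu _⟩) s (fun z z' => hs z z')
  exact ⟨t, ht⟩

end

variable {𝒜 : Type u₁} [Category.{v₁} 𝒜] {ℬ : Type u} [Category.{v} ℬ]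
  [IsLocallyFinitelyPresentable.{v} ℬ] {U : 𝒜 ⥤ ℬ} {M : RightMultiadjoint U} {B : ℬ}
  {X : TopCat.{v}} {F : X.Presheaf ℬ} {n : Under B}

/-! ### Sections over `cod n` -/

/-- A stalk is a filtered colimit over neighbourhoods, so a germ under `B` spreads out. The germ of
`t` need not be recorded: `section_ext` will give uniqueness. -/
lemma isBasic.exists_hom_of_stalk (hn : isBasic U B n) (φ : B ⟶ F.obj (op ⊤)) (y : X)
    (f : n.right ⟶ F.stalk y) (hf : n.hom ≫ f = φ ≫ F.germ ⊤ y trivial) :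
    ∃ (u : Opens X) (_ : y ∈ u) (t : n.right ⟶ F.obj (op u)),
      n.hom ≫ t = φ ≫ F.map (homOfLE le_top).op := by
  obtain ⟨u, t, ht, -⟩ := hn.exists_hom_of_isColimit (J := (OpenNhds y)ᵒᵖ)
    (colimit.isColimit ((OpenNhds.inclusion y).op ⋙ F))
    { app := fun u => φ ≫ F.map (homOfLE le_top).op
      naturality := fun u w k => by
        refine (Category.id_comp _).trans ?_
        refine Eq.trans ?_ (Category.assoc _ _ _).symm
        congr 1
        exact F.map_comp _ _ } f (fun u =>
      ((Category.assoc _ _ _).trans (congrArg (φ ≫ ·)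
        (F.germ_res (homOfLE le_top) y u.unop.2))).trans hf.symm)
  exact ⟨u.unop.1, u.unop.2, t, ht⟩

lemma isBasic.exists_eq_of_germ (hn : isBasic U B n) {w : Opens X} {y : X} (hy : y ∈ w)
    (s t : n.right ⟶ F.obj (op w)) (h : n.hom ≫ s = n.hom ≫ t)
    (h' : s ≫ F.germ w y hy = t ≫ F.germ w y hy) :
    ∃ (u : Opens X) (_ : y ∈ u) (k : u ⟶ w), s ≫ F.map k.op = t ≫ F.map k.op := by
  obtain ⟨u, k, hk⟩ := hn.exists_eq_of_isColimit (J := (OpenNhds y)ᵒᵖ)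
    (colimit.isColimit ((OpenNhds.inclusion y).op ⋙ F)) (j := op ⟨w, hy⟩) s t h h'
  exact ⟨u.unop.1, u.unop.2, (OpenNhds.inclusion y).map k.unop, hk⟩

variable {A : X → 𝒜} {i : ∀ y, F.stalk y ≅ U.obj (A y)} {φ : B ⟶ F.obj (op ⊤)} {p : X → M.X B}
  {a : ∀ y, M.obj (p y) ⟶ A y}

/-- The germ of `t` closes a square over `U.map (a y)`, whose filler factorizes the local unit. Thus
`p` maps `w` into `D_n`. -/
lemma isBasic.exists_lift_germ (hn : isBasic U B n)
    (hp : ∀ y, M.unit (p y) ≫ U.map (a y) = φ ≫ F.germ ⊤ y trivial ≫ (i y).hom)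
    {w : Opens X} (t : n.right ⟶ F.obj (op w)) (ht : n.hom ≫ t = φ ≫ F.map (homOfLE le_top).op)
    (y : X) (hy : y ∈ w) :
    ∃ m : n.right ⟶ U.obj (M.obj (p y)), n.hom ≫ m = M.unit (p y) ∧
      m ≫ U.map (a y) = t ≫ F.germ w y hy ≫ (i y).hom := by
  refine (hn.existsUnique_lift (a y) _ _ ?_).exists
  rw [hp, reassoc_of% ht, TopCat.Presheaf.germ_res_assoc]

lemma isBasic.exists_local_section (hn : isBasic U B n)
    (hp : ∀ y, M.unit (p y) ≫ U.map (a y) = φ ≫ F.germ ⊤ y trivial ≫ (i y).hom)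
    (y : X) (hy : M.Le n (p y)) :
    ∃ (u : Opens X) (_ : y ∈ u) (t : n.right ⟶ F.obj (op u)),
      n.hom ≫ t = φ ≫ F.map (homOfLE le_top).op := by
  obtain ⟨m, hm⟩ := hy
  refine hn.exists_hom_of_stalk φ y (m ≫ U.map (a y) ≫ (i y).inv) ?_
  rw [reassoc_of% hm, reassoc_of% (hp y), Iso.hom_inv_id, Category.comp_id]

/-- The preimage of `D_n` consists of the points near which `φ` extends along `n` to a local
section, an open condition. -/
lemma continuous_of_unit_comp
    (hp : ∀ y, M.unit (p y) ≫ U.map (a y) = φ ≫ F.germ ⊤ y trivial ≫ (i y).hom) :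
    @Continuous _ _ _ (M.spectralTopology B) p := by
  refine continuous_generateFrom_iff.2 ?_
  rintro _ ⟨n, rfl⟩
  refine isOpen_iff_forall_mem_open.2 fun y hy => ?_
  obtain ⟨u, hu, t, ht⟩ := n.property.exists_local_section hp y hy
  refine ⟨u, fun z hz => ?_, u.isOpen, hu⟩
  obtain ⟨m, hm, -⟩ := n.property.exists_lift_germ hp t ht z hz
  exact ⟨m, hm⟩

/-- Rigidity over `U.map (a y)` equates the germs, finite presentability makes this a local
equality, and the sheaf condition a global one. -/
lemma isBasic.section_ext (hn : isBasic U B n) (hM : M.DiersCondition) (hF : F.IsSheaf)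
    (hp : ∀ y, M.unit (p y) ≫ U.map (a y) = φ ≫ F.germ ⊤ y trivial ≫ (i y).hom)
    {w : Opens X} {s t : n.right ⟶ F.obj (op w)}
    (hs : n.hom ≫ s = φ ≫ F.map (homOfLE le_top).op)
    (ht : n.hom ≫ t = φ ≫ F.map (homOfLE le_top).op) : s = t := by
  refine sheaf_hom_ext hF fun y hy => ?_
  refine hn.exists_eq_of_germ hy s t (hs.trans ht.symm) ?_
  rw [← cancel_mono (i y).hom, Category.assoc, Category.assoc]
  refine hM.hom_ext_of_comp hn (a y) ?_ ?_
  · rw [hp, reassoc_of% hs, TopCat.Presheaf.germ_res_assoc]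
  · rw [hp, reassoc_of% ht, TopCat.Presheaf.germ_res_assoc]

lemma isBasic.exists_section (hn : isBasic U B n) (hM : M.DiersCondition) (hF : F.IsSheaf)
    (hp : ∀ y, M.unit (p y) ≫ U.map (a y) = φ ≫ F.germ ⊤ y trivial ≫ (i y).hom)
    {w : Opens X} (hw : ∀ y ∈ w, M.Le n (p y)) :
    ∃ t : n.right ⟶ F.obj (op w), n.hom ≫ t = φ ≫ F.map (homOfLE le_top).op := by
  choose u hu t ht using fun y : w => hn.exists_local_section hp y.1 (hw y.1 y.2)
  have hres {w₁ w₂ : Opens X} (k : w₁ ⟶ w₂) (s : n.right ⟶ F.obj (op w₂))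
      (hs : n.hom ≫ s = φ ≫ F.map (homOfLE le_top).op) :
      n.hom ≫ s ≫ F.map k.op = φ ≫ F.map (homOfLE le_top).op := by
    rw [reassoc_of% hs, ← F.map_comp]
    rfl
  -- The neighbourhoods `u y` need not lie in `w`. Agreement on overlaps is automatic by
  -- `section_ext`.
  have ht' (y : w) := hres (homOfLE (inf_le_left : u y ⊓ w ≤ u y)) (t y) (ht y)
  obtain ⟨s, hs⟩ := sheaf_exists_gluing hF (fun y => u y ⊓ w) (fun y => ⟨hu y, y.2⟩)
    (fun y => homOfLE inf_le_right) (fun y => t y ≫ F.map (homOfLE inf_le_left).op)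
    (fun y z => hn.section_ext hM hF hp (hres _ _ (ht' y)) (hres _ _ (ht' z)))
  refine ⟨s, sheaf_hom_ext hF fun y hy => ⟨u ⟨y, hy⟩ ⊓ w, ⟨hu _, hy⟩, homOfLE inf_le_right, ?_⟩⟩
  rw [Category.assoc, hs ⟨y, hy⟩, ht', Category.assoc, ← F.map_comp]
  rfl

end Diers

namespace Diers

variable {𝒜 : Type u₁} [Category.{v₁} 𝒜] {ℬ : Type u} [Category.{v} ℬ]
  {U : 𝒜 ⥤ ℬ} {M : RightMultiadjoint U}

namespace RightMultiadjoint

/-! ### Morphisms from the structural sheaf -/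

lemma sigma_ext_of_unit_comp {B : ℬ} {A : 𝒜} {p q : Σ x : M.X B, M.obj x ⟶ A}
    (h : M.unit p.1 ≫ U.map p.2 = M.unit q.1 ≫ U.map q.2) : p = q :=
  (M.existsUnique_factorization (M.unit q.1 ≫ U.map q.2)).unique h rfl

namespace StructuralSheaf

variable {B : ℬ} (S : M.StructuralSheaf B)

/-- Morphisms from the structural sheaf to a sheaf are given by natural families of morphisms from
`cod n` to the sections on `D_n`. -/
lemma exists_desc {G : (M.diersSpace B).Presheaf ℬ} (hG : G.IsSheaf)
    (t : ∀ n : Basic U B, n.obj.right ⟶ G.obj (op (M.basicOpen n)))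
    (ht : ∀ (n m : Basic U B) (f : n ⟶ m),
      f.hom.right ≫ t m = t n ≫ G.map (homOfLE (M.basicOpen_anti f)).op) :
    ∃ c : S.sheaf ⟶ G, ∀ n, S.sec n ≫ c.app (op (M.basicOpen n)) = t n := by
  let τ : cod U B ⟶ M.D B ⋙ G := { app := t, naturality := fun n m f => ht n m f }
  let e := S.isLan.homFrom (Functor.LeftExtension.mk G τ)
  obtain ⟨c, hc⟩ := (S.isSheafification G hG).2 e.right
  refine ⟨c, fun n => ?_⟩
  have h₁ : S.presec n ≫ e.right.app (op (M.basicOpen n)) = t n :=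
    congrArg (fun k => NatTrans.app k n) (StructuredArrow.w e)
  rw [← h₁, ← hc, sec_eq, Category.assoc]
  rfl

lemma hom_ext {G : (M.diersSpace B).Presheaf ℬ} (hG : G.IsSheaf) {c c' : S.sheaf ⟶ G}
    (h : ∀ n, S.sec n ≫ c.app (op (M.basicOpen n)) = S.sec n ≫ c'.app (op (M.basicOpen n))) :
    c = c' := by
  refine (S.isSheafification G hG).1 (NatTrans.ext (funext fun u => ?_))
  refine S.presheaf_obj_hom_ext (u := u.unop) fun n k => ?_
  have h₁ := (S.γ ≫ c).naturality k.op
  have h₂ := (S.γ ≫ c').naturality k.op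
  have h₃ := h n
  rw [sec_eq, Category.assoc, Category.assoc, ← NatTrans.comp_app, ← NatTrans.comp_app] at h₃
  refine (congrArg (S.presec n ≫ ·) h₁).trans
    (Eq.trans ?_ (congrArg (S.presec n ≫ ·) h₂).symm)
  exact (Category.assoc _ _ _).symm.trans
    ((congrArg (· ≫ G.map k.op) h₃).trans (Category.assoc _ _ _))

variable [IsLocallyFinitelyPresentable.{v} ℬ]

/-- Naturality along the map to `n` from the identity of `B`, which is initial in `𝒟_B`. -/
lemma hom_comp_sec (n : Basic U B) :
    n.obj.hom ≫ S.sec n = S.η ≫ S.sheaf.map (homOfLE le_top).op := by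
  let f : basicId U B ⟶ n := ObjectProperty.homMk (Under.homMk n.obj.hom (Category.id_comp _))
  refine (S.sec_map f (M.basicOpen_anti f)).symm.trans ?_
  exact (congrArg (S.sec (basicId U B) ≫ ·) (S.sheaf.map_comp _ _)).trans
    (Category.assoc _ _ _).symm

end StructuralSheaf

namespace StructuralSheaf

variable [IsLocallyFinitelyPresentable.{v} ℬ] {B : ℬ} (S : M.StructuralSheaf B)
   {X : TopCat.{v}} {F : X.Presheaf ℬ} {A : X → 𝒜} {i : ∀ y, F.stalk y ≅ U.obj (A y)}
   {φ : B ⟶ F.obj (op ⊤)} {p : X ⟶ M.diersSpace B} {a : ∀ y, M.obj (B := B) (p y) ⟶ A y}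

lemma hom_comp_sec_app {G : (M.diersSpace B).Presheaf ℬ} (c : S.sheaf ⟶ G) (n : Basic U B) :
    n.obj.hom ≫ S.sec n ≫ c.app (op (M.basicOpen n)) =
      (S.η ≫ c.app (op ⊤)) ≫ G.map (homOfLE le_top).op := by
  rw [← Category.assoc, hom_comp_sec, Category.assoc, c.naturality, Category.assoc]

lemma comorphism_ext (hM : M.DiersCondition) (hF : F.IsSheaf)
    (hp : ∀ y, M.unit (B := B) (p y) ≫ U.map (a y) = φ ≫ F.germ ⊤ y trivial ≫ (i y).hom)
    {c c' : S.sheaf ⟶ (TopCat.Presheaf.pushforward ℬ p).obj F}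
    (hc : S.η ≫ c.app (op ⊤) = φ) (hc' : S.η ≫ c'.app (op ⊤) = φ) : c = c' := by
  refine S.hom_ext (TopCat.Sheaf.pushforward_sheaf_of_sheaf p hF) fun n => ?_
  refine n.property.section_ext hM hF hp ((S.hom_comp_sec_app c n).trans ?_)
    ((S.hom_comp_sec_app c' n).trans ?_)
  · rw [hc]; rfl
  · rw [hc']; rfl

/-- The sections under `B` on the preimages of the `D_n` are natural in `n` because they are unique.
-/
lemma exists_comorphism (hM : M.DiersCondition) (hF : F.IsSheaf)
    (hp : ∀ y, M.unit (B := B) (p y) ≫ U.map (a y) = φ ≫ F.germ ⊤ y trivial ≫ (i y).hom) :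
    ∃ c : S.sheaf ⟶ (TopCat.Presheaf.pushforward ℬ p).obj F, S.η ≫ c.app (op ⊤) = φ := by
  choose t ht using fun n : Basic U B => n.property.exists_section hM hF hp
    (w := (Opens.map p).obj (M.basicOpen n)) (fun y hy => hy)
  obtain ⟨c, hc⟩ := S.exists_desc (TopCat.Sheaf.pushforward_sheaf_of_sheaf p hF) t
    (fun n m f => by
      refine n.property.section_ext hM hF hp (w := (Opens.map p).obj (M.basicOpen m)) ?_ ?_
      · rw [← ht m, ← Category.assoc, Under.w]
      · rw [← Category.assoc, ht n, Category.assoc]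
        congr 1
        exact (F.map_comp _ _).symm)
  refine ⟨c, ?_⟩
  -- The component at the identity of `B` recovers `φ`; its basic open set is the whole space but
  -- not literally `⊤`, hence the restrictions.
  let s : B ⟶ S.sheaf.obj (op (M.basicOpen (basicId U B))) := S.sec (basicId U B)
  let t' : B ⟶ F.obj (op ((Opens.map p).obj (M.basicOpen (basicId U B)))) := t (basicId U B)
  have h₁ : s ≫ c.app (op (M.basicOpen (basicId U B))) = t' := hc (basicId U B)
  have h₂ : t' = φ ≫ F.map (homOfLE le_top).op :=
    (Category.id_comp _).symm.trans (ht (basicId U B))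
  have h₃ : S.η = s ≫ S.sheaf.map _ := rfl
  rw [h₃, Category.assoc, c.naturality, ← Category.assoc, h₁, h₂, Category.assoc]
  exact Eq.trans (congrArg (φ ≫ ·) (Eq.trans (F.map_comp _ _).symm (F.map_id _)))
    (Category.comp_id φ)

end StructuralSheaf

end RightMultiadjoint

end Diers

namespace Diers

variable {𝒜 : Type u₁} [Category.{v₁} 𝒜] {ℬ : Type u} [Category.{v} ℬ]
  [IsLocallyFinitelyPresentable.{v} ℬ] {U : 𝒜 ⥤ ℬ} {M : RightMultiadjoint U}

namespace RightMultiadjoint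

namespace StructuralSheaf

/-! ### The universal property of the spectrum -/

variable {B : ℬ} {S : M.StructuralSheaf B}

lemma StalkIdentification.η_germ_iso (σ : S.StalkIdentification) (x : M.diersSpace B) :
    S.η ≫ S.sheaf.germ ⊤ x trivial ≫ (σ.iso x).hom = M.unit (B := B) x := by
  refine Eq.trans ?_ (σ.sec_germ_iso (basicId U B) x (M.unit (B := B) x) (Category.id_comp _))
  refine (Category.assoc _ _ _).trans (congrArg (S.sec (basicId U B) ≫ ·) ?_)
  exact S.sheaf.germ_res_assoc _ x _ _

variable (S) (σ : S.StalkIdentification) (X : USpace U)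

/-- By unique factorization, this makes the transpose of `f` determine its points and its local
maps. -/
lemma unit_comp_localMap (f : S.toUSpace σ ⟶ X) (y : X.toSheafedSpace) :
    M.unit (B := B) (f.toSheafedHom.hom.base y) ≫ U.map (f.localMap y) =
      (S.η ≫ f.toSheafedHom.hom.c.app (op ⊤)) ≫ X.toSheafedSpace.presheaf.germ ⊤ y trivial ≫
        (X.stalkIso y).hom := by
  have h₁ := σ.η_germ_iso (f.toSheafedHom.hom.base y)
  have h₂ := f.stalk_comp y
  have h₃ := PresheafedSpace.stalkMap_germ f.toSheafedHom.hom ⊤ y trivial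
  refine (congrArg (· ≫ _) h₁.symm).trans ?_
  refine (Category.assoc _ _ _).trans ?_
  refine Eq.trans ?_ (Category.assoc _ _ _).symm
  refine congrArg (S.η ≫ ·) ?_
  refine (Category.assoc _ _ _).trans ?_
  refine (congrArg (S.sheaf.germ ⊤ (f.toSheafedHom.hom.base y) trivial ≫ ·) h₂.symm).trans ?_
  refine (Category.assoc _ _ _).symm.trans ?_
  exact (congrArg (· ≫ (X.stalkIso y).hom) h₃).trans (Category.assoc _ _ _)

lemma toUSpace_hom_ext (hM : M.DiersCondition) {f g : S.toUSpace σ ⟶ X}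
    (h : S.η ≫ (USpace.Γ U).map f = S.η ≫ (USpace.Γ U).map g) : f = g := by
  have hf := S.unit_comp_localMap σ X f
  have hg := S.unit_comp_localMap σ X g
  have h' (y : X.toSheafedSpace) : (⟨f.toSheafedHom.hom.base y, f.localMap y⟩ :
      Σ x : M.X B, M.obj x ⟶ X.localObj y) = ⟨g.toSheafedHom.hom.base y, g.localMap y⟩ := by
    refine sigma_ext_of_unit_comp ((hf y).trans (Eq.trans ?_ (hg y).symm))
    exact congrArg (· ≫ X.toSheafedSpace.presheaf.germ ⊤ y trivial ≫ (X.stalkIso y).hom) h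
  obtain ⟨⟨⟨p, c⟩⟩, a, hc⟩ := f
  obtain ⟨⟨⟨q, c'⟩⟩, b, hc'⟩ := g
  obtain rfl : p = q := by
    ext y
    exact congrArg Sigma.fst (h' y)
  obtain rfl : a = b := funext fun y => eq_of_heq (Sigma.mk.inj (h' y)).2
  obtain rfl : c = c' := S.comorphism_ext hM X.toSheafedSpace.IsSheaf hf rfl h.symm
  rfl

lemma exists_toUSpace_hom (hM : M.DiersCondition) (φ : B ⟶ (USpace.Γ U).obj X) :
    ∃ f : S.toUSpace σ ⟶ X, S.η ≫ (USpace.Γ U).map f = φ := by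
  choose p hp _ using fun y : X.toSheafedSpace => M.existsUnique_factorization
    (φ ≫ X.toSheafedSpace.presheaf.germ ⊤ y trivial ≫ (X.stalkIso y).hom)
  let q : X.toSheafedSpace.toPresheafedSpace.carrier ⟶ M.diersSpace B :=
    TopCat.ofHom (Y := M.diersSpace B)
      (@ContinuousMap.mk _ _ _ (M.spectralTopology B) (fun y => (p y).1)
        (continuous_of_unit_comp hp))
  obtain ⟨c, hc⟩ := S.exists_comorphism (p := q) (a := fun y => (p y).2) hM
    X.toSheafedSpace.IsSheaf hp
  let f : X.toSheafedSpace ⟶ (S.toUSpace σ).toSheafedSpace :=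
    InducedCategory.homMk (PresheafedSpace.Hom.mk q c)
  refine ⟨{ toSheafedHom := f, localMap := fun y => (p y).2, stalk_comp := fun y => ?_ }, hc⟩
  -- On each `cod n`, both sides are maps under `B` lying over the local unit at `q y`, so rigidity
  -- equates them.
  refine S.stalk_hom_ext fun n hx => ?_
  obtain ⟨m, hm⟩ := hx
  have h₁ := σ.sec_germ_iso n (q y) m hm
  have h₂ := PresheafedSpace.stalkMap_germ f.hom (M.basicOpen n) y ⟨m, hm⟩
  have h₃ : n.obj.hom ≫ S.sec n ≫ c.app (op (M.basicOpen n)) =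
      φ ≫ X.toSheafedSpace.presheaf.map (homOfLE le_top).op :=
    (S.hom_comp_sec_app c n).trans (congrArg (· ≫ _) hc)
  have h₄ := X.toSheafedSpace.presheaf.germ_res (homOfLE le_top) y
    (show y ∈ (Opens.map q).obj (M.basicOpen n) from ⟨m, hm⟩)
  have h₅ : S.sec n ≫ S.sheaf.germ (M.basicOpen n) (q y) ⟨m, hm⟩ ≫
      PresheafedSpace.Hom.stalkMap f.hom y ≫ (X.stalkIso y).hom =
      (S.sec n ≫ c.app (op (M.basicOpen n))) ≫ X.toSheafedSpace.presheaf.germ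
        ((Opens.map q).obj (M.basicOpen n)) y ⟨m, hm⟩ ≫ (X.stalkIso y).hom := by
    refine Eq.trans (congrArg (S.sec n ≫ ·) ?_) (Category.assoc _ _ _).symm
    refine (Category.assoc _ _ _).symm.trans ?_
    exact (congrArg (· ≫ (X.stalkIso y).hom) h₂).trans (Category.assoc _ _ _)
  have h₆ : S.sec n ≫ S.sheaf.germ (M.basicOpen n) (q y) ⟨m, hm⟩ ≫
      (σ.iso (q y)).hom ≫ U.map (p y).2 = m ≫ U.map (p y).2 := by
    refine Eq.trans ?_ (congrArg (· ≫ U.map (p y).2) h₁)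
    exact ((Category.assoc _ _ _).trans (congrArg (S.sec n ≫ ·) (Category.assoc _ _ _))).symm
  refine h₅.trans (Eq.trans ?_ h₆.symm)
  refine hM.hom_ext_of_comp n.property (p y).2 ?_ ?_
  · refine Eq.trans ?_ (hp y).symm
    rw [← Category.assoc, h₃]
    refine (Category.assoc _ _ _).trans (congrArg (φ ≫ ·) ?_)
    exact (Category.assoc _ _ _).symm.trans (congrArg (· ≫ (X.stalkIso y).hom) h₄)
  · rw [← Category.assoc]
    exact congrArg (· ≫ U.map (p y).2) hm

end StructuralSheaf

end RightMultiadjoint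

end Diers

namespace Diers

variable {𝒜 : Type u₁} [Category.{v₁} 𝒜] {ℬ : Type u} [Category.{v} ℬ]
  [IsLocallyFinitelyPresentable.{v} ℬ] {U : 𝒜 ⥤ ℬ} {M : RightMultiadjoint U}

namespace RightMultiadjoint

/-! ### The spectrum functor and its adjunction -/

/-- A family of morphisms between the spectra of objects that is compatible with the morphisms to global
sections is a spectrum functor. -/
def spectrumOfUniversal (hM : M.DiersCondition) (S : ∀ B : ℬ, M.StructuralSheaf B)
    (σ : ∀ B, (S B).StalkIdentification)
    (map : ∀ {B₁ B₂ : ℬ}, (B₁ ⟶ B₂) → ((S B₁).toUSpace (σ B₁) ⟶ (S B₂).toUSpace (σ B₂)))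
    (hmap : ∀ {B₁ B₂ : ℬ} (f : B₁ ⟶ B₂),
      (S B₁).η ≫ (USpace.Γ U).map (map f) = f ≫ (S B₂).η) : M.Spectrum S σ :=
  have unit_comp {B₁ B₂ : ℬ} (f : B₁ ⟶ B₂) (x : M.X B₂) :
      M.unit (B := B₁) ((map f).toSheafedHom.hom.base x) ≫ U.map ((map f).localMap x) =
        (f ≫ (S B₂).η) ≫ (S B₂).sheaf.germ ⊤ (x : M.diersSpace B₂) trivial ≫
          ((σ B₂).iso x).hom :=
    ((S B₁).unit_comp_localMap (σ B₁) _ (map f) x).trans (congrArg (· ≫ _) (hmap f))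
  have unit_comp' {B₁ B₂ : ℬ} (f : B₁ ⟶ B₂) (x : M.X B₂) :
      M.unit (B := B₁) ((map f).toSheafedHom.hom.base x) ≫ U.map ((map f).localMap x) =
        f ≫ M.unit x :=
    (unit_comp f x).trans ((Category.assoc _ _ _).trans
      (congrArg (f ≫ ·) ((σ B₂).η_germ_iso x)))
  { map := map
    map_id := fun B => (S B).toUSpace_hom_ext (σ B) _ hM <| by
      refine (hmap _).trans ((Category.id_comp _).trans ?_)
      exact (Category.comp_id _).symm
    map_comp := fun {B₁ B₂ B₃} f g => (S B₁).toUSpace_hom_ext (σ B₁) _ hM <| by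
      rw [hmap, Functor.map_comp, Category.assoc, ← hmap g]
      exact ((Category.assoc _ _ _).symm.trans (congrArg (· ≫ _) (hmap f).symm)).trans
        (Category.assoc _ _ _)
    unit_comp := unit_comp'
    sec_comp := fun {B₁ B₂} f n₁ n₂ h w => by
      have hle : M.basicOpen n₂ ≤
          (Opens.map (map f).toSheafedHom.hom.base).obj (M.basicOpen n₁) := by
        rintro x ⟨m, hm⟩
        have hw : n₁.obj.hom ≫ h ≫ m = f ≫ n₂.obj.hom ≫ m :=
          (Category.assoc _ _ _).symm.trans ((congrArg (· ≫ m) w).trans (Category.assoc _ _ _))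
        -- The filler over the local map factorizes the local unit under `B₁` through `n₁`.
        obtain ⟨d, ⟨hd, -⟩, -⟩ := n₁.property.existsUnique_lift ((map f).localMap x) _ (h ≫ m)
          ((unit_comp' f x).trans ((congrArg (f ≫ ·) hm.symm).trans hw.symm))
        exact ⟨d, hd⟩
      -- Both composites are maps under `B₁` into sections over `D_{n₂}`.
      refine ⟨hle, n₁.property.section_ext hM (S B₂).isSheaf (unit_comp f)
        (w := M.basicOpen n₂) ?_ ?_⟩
      · refine Eq.trans ?_ (congrArg (· ≫ (S B₂).sheaf.map (homOfLE le_top).op) (hmap f))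
        have h₁ := (S B₁).hom_comp_sec_app (map f).toSheafedHom.hom.c n₁
        refine Eq.trans ?_ ((congrArg (· ≫ (S B₂).sheaf.map (homOfLE hle).op) h₁).trans ?_)
        · exact ((Category.assoc _ _ _).trans
            (congrArg (n₁.obj.hom ≫ ·) (Category.assoc _ _ _))).symm
        · refine (Category.assoc _ _ _).trans (congrArg (_ ≫ ·) ?_)
          exact ((S B₂).sheaf.map_comp _ _).symm
      · rw [reassoc_of% w, (S B₂).hom_comp_sec, Category.assoc] }

end RightMultiadjoint

end Diers

/-! ### The adjunction between the spectrum and global sections -/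

theorem mainTheorem1 {𝒜 : Type u₁} [Category.{v₁} 𝒜] {ℬ : Type u} [Category.{v} ℬ]
    [IsLocallyFinitelyPresentable.{v} ℬ] (U : 𝒜 ⥤ ℬ)
    (M : Diers.RightMultiadjoint U) (hM : M.DiersCondition) :
    (∀ B : ℬ, Nonempty (M.StructuralSheaf B)) ∧
    ∀ S : ∀ B : ℬ, M.StructuralSheaf B,
      ∃ (σ : ∀ B : ℬ, (S B).StalkIdentification)
        (Spec : Diers.RightMultiadjoint.Spectrum S σ)
        (adj : Spec.functor ⊣ Diers.USpace.Γ U),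
        ∀ B : ℬ, adj.unit.app B = (S B).η := by
  refine ⟨M.nonempty_structuralSheaf, fun S => ?_⟩
  let σ (B : ℬ) : (S B).StalkIdentification := ((S B).nonempty_stalkIdentification hM).some
  choose map hmap using fun (B₁ B₂ : ℬ) (f : B₁ ⟶ B₂) =>
    (S B₁).exists_toUSpace_hom (σ B₁) ((S B₂).toUSpace (σ B₂)) hM (f ≫ (S B₂).η)
  let F : M.Spectrum S σ := Diers.RightMultiadjoint.spectrumOfUniversal hM S σ
    (fun {B₁ B₂} f => map B₁ B₂ f) (fun f => hmap _ _ f)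
  let e (B : ℬ) (X : Diers.USpace U) : (F.functor.obj B ⟶ X) ≃ (B ⟶ (Diers.USpace.Γ U).obj X) :=
    Equiv.ofBijective (fun f => (S B).η ≫ (Diers.USpace.Γ U).map f)
      ⟨fun f g h => (S B).toUSpace_hom_ext (σ B) X hM h,
        fun φ => (S B).exists_toUSpace_hom (σ B) X hM φ⟩
  let adj : F.functor ⊣ Diers.USpace.Γ U := Adjunction.mkOfHomEquiv
    { homEquiv := e
      homEquiv_naturality_left_symm := fun {B₁ B₂ X} f g => (e B₁ X).injective <| by
        rw [Equiv.apply_symm_apply]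
        refine Eq.trans ?_ (Category.assoc _ _ _)
        refine Eq.trans ?_ (congrArg
          (· ≫ (Diers.USpace.Γ U).map ((e B₂ X).symm g)) (hmap _ _ f)).symm
        refine Eq.trans ?_ (Category.assoc _ _ _).symm
        exact congrArg (f ≫ ·) ((e B₂ X).apply_symm_apply g).symm
      homEquiv_naturality_right := fun {B X Y} f g =>
        (Category.assoc (S B).η ((Diers.USpace.Γ U).map f) ((Diers.USpace.Γ U).map g)).symm }
  refine ⟨σ, F, adj, fun B => ?_⟩
  -- The unit is the transpose of the identity.
  exact Category.comp_id _
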